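/- Let $K, A, B$ be finite sets with $A, B$ nonempty, let $M_k\in\mathbb R^{A\times B}$ ($k\in K$) be payoff matrices, $p\in\Delta(K)$ an initial distribution (so $K\ne\emptyset$), $Q_a$ ($a\in A$) row-stochastic $K\times K$ matrices, and $n\ge 1$. In the zero-sum game $\Gamma_n(p)$ the state $k_1$ is drawn from $p$ and $k_{t+1}$ from $Q_{a_t}(k_t,\cdot)$; at each stage $t=1,\dots,n$ both players simultaneously choose $a_t\in A$, $b_t\in B$, which are then observed by both, and only player 1 (the informed player) observes the states. A behavior strategy of player 1 is $\sigma=(\sigma_t)_{t\le n}$ with $\sigma_t:K^t\times A^{t-1}\times B^{t-1}\to\Delta(A)$, and one of player 2 (the uninformed player) is $\tau=(\tau_t)_{t\le n}$ with $\tau_t:A^{t-1}\times B^{t-1}\to\Delta(B)$. The payoff, which player 1 maximizes and player 2 minimizes, is $\gamma_n(p,\sigma,\tau)=\mathbf E_{p,\sigma,\tau,Q}\big(\sum_{t=1}^n M_{k_t}(a_t,b_t)\big)$. A security strategy of player 2 is a strategy $\tau^*$ with $\max_\sigma\gamma_n(p,\sigma,\tau^*)=\min_\tau\max_\sigma\gamma_n(p,\sigma,\tau)$.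 Write $I_t=(a_1,\dots,a_{t-1})\in A^{t-1}$ and $F_t=((k_1,\dots,k_t),I_t)\in K^t\times A^{t-1}$ for $1\le t\le n$; given $F_{t-1}$, the pair $(F_{t-1},(k_t,a_{t-1}))$ denotes $F_t$. Consider the linear program in the variables $y_{I_t}\in\Delta(B)$ and $\ell_{F_t}\in\mathbb R$ ($1\le t\le n$, all $I_t$, $F_t$) $$\begin{aligned} \min_{y,\ell}\quad & \sum_{k\in K} p(k)\,\ell_{(k,\emptyset)}\\ \text{s.t.}\quad & \sum_{k_t\in K}\ell_{(F_{t-1},(k_t,a_{t-1}))}\le \ell_{F_{t-1}} && \text{for all } 2\le t\le n,\ F_{t-1}\in K^{t-1}\times A^{t-2},\ a_{t-1}\in A,\\ & \Big(\prod_{t=1}^{n-1}Q_{a_t}(k_t,k_{t+1})\Big)\sum_{t=1}^n\sum_{b\in B} M_{k_t}(a_t,b)\,y_{I_t}(b)\le \ell_{F_n} && \text{for all } (k_1,\dots,k_n)\in K^n,\ (a_1,\dots,a_n)\in A^n . \end{aligned}$$ Then: 1. The game has a value $v_n(p)=\max_\sigma\min_\tau\gamma_n(p,\sigma,\tau)=\min_\tau\max_\sigma\gamma_n(p,\sigma,\tau)$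 (all extrema attained), and the optimum of the linear program is attained and equals $v_n(p)$. 2. If $(y^*,\ell^*)$ is an optimal solution of the linear program, then $\tau^*_t(I_t)=y^*_{I_t}$ (a strategy that depends only on the action history of player 1) is a security strategy of player 2. 3. The size of the linear program, that is, the number of its scalar variables plus the number of its scalar constraints (including those that express $y_{I_t}\in\Delta(B)$), is $O(|K|^n|A|^n|B|)$: there is an absolute constant $c$ such that the size is at most $c\,|K|^n|A|^n|B|$ whenever $|K||A|\ge 2$, and at most $c\,n\,|K|^n|A|^n|B|$ in all cases. -/

import Mathlib

noncomputable section

/-- A finite linear program with variables indexed by `V`: minimize a linear form subject to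
linear equations indexed by `E` and linear inequalities `≤` indexed by `C`. -/
structure LinProg (V E C : Type*) where
  obj : (V → ℝ) →ₗ[ℝ] ℝ
  eqForm : E → (V → ℝ) →ₗ[ℝ] ℝ
  eqRhs : E → ℝ
  leForm : C → (V → ℝ) →ₗ[ℝ] ℝ
  leRhs : C → ℝ

namespace LinProg

variable {V E C : Type*}

def feasible (P : LinProg V E C) : Set (V → ℝ) :=
  {x | (∀ e, P.eqForm e x = P.eqRhs e) ∧ ∀ c, P.leForm c x ≤ P.leRhs c}

/-- `x` is an optimal solution. -/
def IsOptimal (P : LinProg V E C) (x : V → ℝ) : Prop :=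
  x ∈ P.feasible ∧ ∀ x' ∈ P.feasible, P.obj x ≤ P.obj x'

/-- `v` is the (attained) optimal value. -/
def IsOptimum (P : LinProg V E C) (v : ℝ) : Prop :=
  IsLeast (P.obj '' P.feasible) v

/-- Number of scalar variables plus number of scalar constraints. -/
def size [Fintype V] [Fintype E] [Fintype C] (_P : LinProg V E C) : ℕ :=
  Fintype.card V + (Fintype.card E + Fintype.card C)

end LinProg

/-- The data `(K, A, B, M, p, Q)` of a stochastic game controlled by player 1. -/
structure StochGame (K A B : Type*) [Fintype K] where
  M : K → Matrix A B ℝ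
  p : K → ℝ
  p_mem : p ∈ stdSimplex ℝ K
  Q : A → Matrix K K ℝ
  Q_mem : ∀ a k, Q a k ∈ stdSimplex ℝ K

namespace StochGame

/-- Behavior strategies of the informed player in the `n`-stage game. Stages are numbered
`0, …, n - 1`; at stage `t` the player knows `t + 1` states, `t` own actions and `t` actions
of the opponent. -/
abbrev InformedStrategy (K A B : Type*) [Fintype A] (n : ℕ) :=
  (t : Fin n) → (Fin (t + 1) → K) → (Fin t → A) → (Fin t → B) → stdSimplex ℝ A

/-- Behavior strategies of the uninformed player in the `n`-stage game. -/
abbrev UninformedStrategy (A B : Type*) [Fintype B] (n : ℕ) :=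
  (t : Fin n) → (Fin t → A) → (Fin t → B) → stdSimplex ℝ B

/-- The entries of a play that precede stage `t`. -/
def before {X : Type*} {n : ℕ} (x : Fin n → X) (t : Fin n) : Fin t → X :=
  fun i => x ⟨i, by omega⟩

/-- The entries of a play up to and including stage `t`. -/
def upTo {X : Type*} {n : ℕ} (x : Fin n → X) (t : Fin n) : Fin (t + 1) → X :=
  fun i => x ⟨i, by omega⟩

variable {K A B : Type*} [Fintype K] [Fintype A] [Fintype B] {n : ℕ}

/-- The product of the transition probabilities along `n` stages (`n - 1` transitions). -/
def transProb (G : StochGame K A B) (k : Fin n → K) (a : Fin n → A) : ℝ :=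
  ∏ t : Fin (n - 1),
    G.Q (a ⟨t, by omega⟩) (k ⟨t, by omega⟩) (k ⟨t + 1, by omega⟩)

/-- The probability of the play `(k, a, b)` of the `n`-stage game, `1 ≤ n`. -/
def playProb [NeZero n] (G : StochGame K A B) (σ : InformedStrategy K A B n)
    (τ : UninformedStrategy A B n) (k : Fin n → K) (a : Fin n → A) (b : Fin n → B) : ℝ :=
  G.p (k 0) * G.transProb k a *
    ∏ t : Fin n, ((σ t (upTo k t) (before a t) (before b t)).1 (a t) *
      (τ t (before a t) (before b t)).1 (b t))

/-- The total expected payoff of the informed player. -/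
def payoff [NeZero n] (G : StochGame K A B) (σ : InformedStrategy K A B n)
    (τ : UninformedStrategy A B n) : ℝ :=
  ∑ k : Fin n → K, ∑ a : Fin n → A, ∑ b : Fin n → B,
    G.playProb σ τ k a b * ∑ t : Fin n, G.M (k t) (a t) (b t)

/-- `v = max_σ min_τ`, both extrema being attained. -/
def IsMaxmin (G : StochGame K A B) (n : ℕ) [NeZero n] (v : ℝ) : Prop :=
  IsGreatest {m | ∃ σ : InformedStrategy K A B n,
    IsLeast (Set.range fun τ : UninformedStrategy A B n => G.payoff σ τ) m} v

/-- `v = min_τ max_σ`, both extrema being attained. -/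
def IsMinmax (G : StochGame K A B) (n : ℕ) [NeZero n] (v : ℝ) : Prop :=
  IsLeast {m | ∃ τ : UninformedStrategy A B n,
    IsGreatest (Set.range fun σ : InformedStrategy K A B n => G.payoff σ τ) m} v

/-- `v` is the value of the `n`-stage game. -/
def IsValue (G : StochGame K A B) (n : ℕ) [NeZero n] (v : ℝ) : Prop :=
  G.IsMaxmin n v ∧ G.IsMinmax n v

/-- `τ` guarantees the security level (minmax value) of the uninformed player. -/
def IsSecurityStrategy [NeZero n] (G : StochGame K A B) (τ : UninformedStrategy A B n) : Prop :=
  ∃ v, G.IsMinmax n v ∧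
    IsGreatest (Set.range fun σ : InformedStrategy K A B n => G.payoff σ τ) v

/-! The linear program -/

/-- Action histories of the informed player at the beginning of a stage. -/
abbrev ActHist (A : Type*) (n : ℕ) := (t : Fin n) × (Fin t → A)

/-- Full information of the informed player at the beginning of a stage. -/
abbrev FullHist (K A : Type*) (n : ℕ) := (t : Fin n) × (Fin (t + 1) → K) × (Fin t → A)

/-- The scalar variables: the coordinates of the `y_I`, and the `ℓ_F`. -/
abbrev LPVar (K A B : Type*) (n : ℕ) := (ActHist A n × B) ⊕ FullHist K A n

/-- A full information at a stage `t` that is not the last one, followed by the action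
played at stage `t` (the last entry of the second component). -/
abbrev LPStep (K A : Type*) (n : ℕ) :=
  (t : Fin (n - 1)) × (Fin (t + 1) → K) × (Fin (t + 1) → A)

/-- The inequality constraints: nonnegativity of `y`, the recursive constraints, and the
terminal constraints. -/
abbrev LPIneq (K A B : Type*) (n : ℕ) :=
  (ActHist A n × B) ⊕ (LPStep K A n ⊕ ((Fin n → K) × (Fin n → A)))

/-- The coordinate `y_I(b)` as a linear form. -/
def yVar (I : ActHist A n) (b : B) : (LPVar K A B n → ℝ) →ₗ[ℝ] ℝ :=
  LinearMap.proj (Sum.inl (I, b))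

/-- The variable `ℓ_F` as a linear form. -/
def lVar (F : FullHist K A n) : (LPVar K A B n → ℝ) →ₗ[ℝ] ℝ :=
  LinearMap.proj (Sum.inr F)

/-- The initial full information `(k, ∅)`. -/
def initHist [NeZero n] (k : K) : FullHist K A n :=
  ⟨⟨0, NeZero.pos n⟩, fun _ => k, Fin.elim0⟩

/-- The full information at the last stage of a play. -/
def lastHist [NeZero n] (k : Fin n → K) (a : Fin n → A) : FullHist K A n :=
  let t : Fin n := ⟨n - 1, by have := NeZero.pos n; omega⟩
  ⟨t, upTo k t, before a t⟩

/-- The full information from which a step starts. -/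
def stepSource (s : LPStep K A n) : FullHist K A n :=
  ⟨⟨s.1, by omega⟩, s.2.1, Fin.init s.2.2⟩

/-- The full information reached by a step if the next state is `k`. -/
def stepTarget (s : LPStep K A n) (k : K) : FullHist K A n :=
  ⟨⟨s.1 + 1, by omega⟩, Fin.snoc s.2.1 k, s.2.2⟩

/-- Minimize `∑ k, p k * ℓ_(k, ∅)` subject to
* `y_I ∈ Δ(B)` for all action histories `I`;
* `∑ k', ℓ_(F, (k', a)) ≤ ℓ_F` for every full information `F` before the last stage and all `a`;
* `(∏ Q) * ∑ t, M_(k_t)(a_t, :) y_(I_t) ≤ ℓ_(F_n)` for all `k_1, …, k_n` and `a_1, …, a_n`. -/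
def uninformedLP [NeZero n] (G : StochGame K A B) :
    LinProg (LPVar K A B n) (ActHist A n) (LPIneq K A B n) where
  obj := ∑ k, G.p k • lVar (initHist k)
  eqForm I := ∑ b, yVar I b
  eqRhs _ := 1
  leForm
    | Sum.inl (I, b) => -yVar I b
    | Sum.inr (Sum.inl s) => (∑ k, lVar (stepTarget s k)) - lVar (stepSource s)
    | Sum.inr (Sum.inr (k, a)) =>
        G.transProb k a • (∑ t : Fin n, ∑ b, G.M (k t) (a t) b • yVar ⟨t, before a t⟩ b)
          - lVar (lastHist k a)
  leRhs _ := 0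

end StochGame

end

/-! In behavior strategies the payoff is a polynomial. It becomes bilinear when player 1 is
described by a realization plan `x` (probabilities of action sequences given the states) and player
2 by mixed actions `y` that depend on player 1's past actions only. Nothing is lost, because the
actions of player 2 do not affect the states. If player 2 ignores his own past actions, every
strategy of player 1 amounts to a plan (`payoff_eq_planPayoff`); if player 1 ignores the actions of
player 2, every strategy of player 2 amounts to its conditional marginals (`payoff_planOf`). Both
domains are convex and compact, so Sion's theorem yields a saddle point (`exists_saddle`). Its plan
comes from a behavior strategy (`IsPlan.exists_planOf`), which gives the value.

For fixed `y`, the best reply of player 1 is a linear maximization over plans, and the `ℓ` are its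
dual variables: weak duality is `IsPlan.sum_le`, and backward induction closes the gap
(`exists_pureStrategy_eq`). The linear program therefore minimizes the best-reply payoff over `y`.
Its size is bounded by comparing the sums over stages with powers of |K||A|. -/

noncomputable section

namespace StochGame

/-! ### Truncating and extending histories -/

section Histories

variable {X K A B : Type*}

theorem sum_snoc [Fintype X] {m : ℕ} (F : (Fin (m + 1) → X) → ℝ) :
    ∑ f, F f = ∑ g : Fin m → X, ∑ x, F (Fin.snoc g x) := by
  rw [← (Fin.snocEquiv fun _ => X).sum_comp, Fintype.sum_prod_type_right]
  rfl

@[simp] theorem before_castSucc {m : ℕ} (x : Fin (m + 1) → X) (s : Fin m) :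
    before x s.castSucc = before (Fin.init x) s := rfl

@[simp] theorem before_last {m : ℕ} (x : Fin (m + 1) → X) :
    before x (Fin.last m) = Fin.init x := rfl

@[simp] theorem upTo_castSucc {m : ℕ} (x : Fin (m + 1) → X) (s : Fin m) :
    upTo x s.castSucc = upTo (Fin.init x) s := rfl

@[simp] theorem upTo_last {m : ℕ} (x : Fin (m + 1) → X) : upTo x (Fin.last m) = x := rfl

theorem snoc_zero {m : ℕ} (x : Fin (m + 1) → X) (y : X) :
    (Fin.snoc x y : Fin (m + 2) → X) 0 = x 0 := by
  rw [Fin.snoc_apply_zero]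

theorem init_zero {m : ℕ} (x : Fin (m + 2) → X) : Fin.init x 0 = x 0 := rfl

end Histories

/-! ### Realization plans of the informed player -/

section Plans

variable {K A : Type*} [Fintype A]

/-- Realization plans of the informed player: `x t k a` is the probability that the actions
`a` are chosen at the first `t` stages when the states are `k`. -/
structure IsPlan (x : (t : ℕ) → (Fin t → K) → (Fin t → A) → ℝ) : Prop where
  zero : ∀ k a, x 0 k a = 1
  nonneg : ∀ t k a, 0 ≤ x t k a
  sum_eq : ∀ t (k : Fin (t + 1) → K) (a : Fin t → A),
    ∑ a', x (t + 1) k (Fin.snoc a a') = x t (Fin.init k) a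

theorem IsPlan.le_one {x : (t : ℕ) → (Fin t → K) → (Fin t → A) → ℝ} (hx : IsPlan x) :
    ∀ t k a, x t k a ≤ 1
  | 0, k, a => (hx.zero k a).le
  | t + 1, k, a => by
    refine le_trans ?_ (hx.le_one t (Fin.init k) (Fin.init a))
    rw [← hx.sum_eq]
    refine le_trans (le_of_eq ?_) (Finset.single_le_sum
      (f := fun a' => x (t + 1) k (Fin.snoc (Fin.init a) a'))
      (fun _ _ => hx.nonneg _ _ _) (Finset.mem_univ (a (Fin.last t))))
    simp only [Fin.snoc_init_self]

theorem convex_isPlan :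
    Convex ℝ {x : (t : ℕ) → (Fin t → K) → (Fin t → A) → ℝ | IsPlan x} := by
  intro x hx y hy α β hα hβ hαβ
  refine ⟨fun k a => ?_, fun t k a => ?_, fun t k a => ?_⟩
  · simp [hx.zero, hy.zero, hαβ]
  · exact add_nonneg (mul_nonneg hα (hx.nonneg t k a)) (mul_nonneg hβ (hy.nonneg t k a))
  · simp only [Pi.add_apply, Pi.smul_apply, smul_eq_mul, Finset.sum_add_distrib,
      ← Finset.mul_sum, hx.sum_eq, hy.sum_eq]

/-- Plans live on all stages `t : ℕ`, so this is Tychonoff: the conditions are closed, each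
involving finitely many coordinates, and they confine every coordinate to [0, 1]. -/
theorem isCompact_isPlan :
    IsCompact {x : (t : ℕ) → (Fin t → K) → (Fin t → A) → ℝ | IsPlan x} := by
  have hbox : IsCompact (Set.univ.pi fun t : ℕ => Set.univ.pi fun _ : Fin t → K =>
      Set.univ.pi fun _ : Fin t → A => Set.Icc (0 : ℝ) 1) :=
    isCompact_univ_pi fun _ => isCompact_univ_pi fun _ => isCompact_univ_pi fun _ => isCompact_Icc
  refine hbox.of_isClosed_subset ?_ fun x hx t _ k _ a _ => ⟨hx.nonneg t k a, hx.le_one t k a⟩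
  have : {x : (t : ℕ) → (Fin t → K) → (Fin t → A) → ℝ | IsPlan x} =
      (⋂ k, ⋂ a, {x | x 0 k a = 1}) ∩ (⋂ t, ⋂ k, ⋂ a, {x | 0 ≤ x t k a}) ∩
      ⋂ t : ℕ, ⋂ k : Fin (t + 1) → K, ⋂ a : Fin t → A,
        {x | ∑ a', x (t + 1) k (Fin.snoc a a') = x t (Fin.init k) a} := by
    ext x
    simp only [Set.mem_ofPred_eq, Set.mem_inter_iff, Set.mem_iInter]
    exact ⟨fun h => ⟨⟨h.zero, h.nonneg⟩, h.sum_eq⟩, fun h => ⟨h.1.1, h.1.2, h.2⟩⟩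
  rw [this]
  refine ((isClosed_iInter fun k => isClosed_iInter fun a => ?_).inter
    (isClosed_iInter fun t => isClosed_iInter fun k => isClosed_iInter fun a => ?_)).inter
    (isClosed_iInter fun t => isClosed_iInter fun k => isClosed_iInter fun a => ?_)
  · exact isClosed_eq (by fun_prop) (by fun_prop)
  · exact isClosed_le (by fun_prop) (by fun_prop)
  · exact isClosed_eq (by fun_prop) (by fun_prop)

/-- The probability that the first `m` actions are `a` when the states are `k` and the informed
player uses a behavior strategy that ignores the actions of the opponent. -/
def planOf (s : (t : ℕ) → (Fin (t + 1) → K) → (Fin t → A) → stdSimplex ℝ A)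
    (m : ℕ) (k : Fin m → K) (a : Fin m → A) : ℝ :=
  ∏ t : Fin m, (s t (upTo k t) (before a t)).1 (a t)

theorem planOf_succ (s : (t : ℕ) → (Fin (t + 1) → K) → (Fin t → A) → stdSimplex ℝ A)
    {m : ℕ} (k : Fin (m + 1) → K) (a : Fin (m + 1) → A) :
    planOf s (m + 1) k a =
      planOf s m (Fin.init k) (Fin.init a) * (s m k (Fin.init a)).1 (a (Fin.last m)) := by
  rw [planOf, Fin.prod_univ_castSucc]
  rfl

theorem isPlan_planOf (s : (t : ℕ) → (Fin (t + 1) → K) → (Fin t → A) → stdSimplex ℝ A) :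
    IsPlan (planOf s) where
  zero k a := by simp [planOf]
  nonneg t k a := Finset.prod_nonneg fun i _ => (s i _ _).2.1 _
  sum_eq t k a := by
    simp only [planOf_succ, Fin.init_snoc, Fin.snoc_last, ← Finset.mul_sum, (s t k a).2.2, mul_one]

/-- Every realization plan is generated by a behavior strategy. -/
theorem IsPlan.exists_planOf [Nonempty A] {x : (t : ℕ) → (Fin t → K) → (Fin t → A) → ℝ}
    (hx : IsPlan x) :
    ∃ s : (t : ℕ) → (Fin (t + 1) → K) → (Fin t → A) → stdSimplex ℝ A, planOf s = x := by
  have key : ∀ t (k : Fin (t + 1) → K) (a : Fin t → A), ∃ s : stdSimplex ℝ A,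
      ∀ a', x (t + 1) k (Fin.snoc a a') = x t (Fin.init k) a * s.1 a' := by
    intro t k a
    -- After a history of probability zero all continuations have probability zero, so any mixed
    -- action will do; otherwise conditional probabilities are used.
    by_cases h : x t (Fin.init k) a = 0
    · refine ⟨Classical.arbitrary _, fun a' => ?_⟩
      have h0 := hx.sum_eq t k a
      rw [h, Finset.sum_eq_zero_iff_of_nonneg fun _ _ => hx.nonneg _ _ _] at h0
      rw [h0 a' (Finset.mem_univ _), h, zero_mul]
    · refine ⟨⟨fun a' => x (t + 1) k (Fin.snoc a a') / x t (Fin.init k) a,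
        fun a' => div_nonneg (hx.nonneg _ _ _) (hx.nonneg _ _ _), ?_⟩, fun a' => ?_⟩
      · rw [← Finset.sum_div, hx.sum_eq, div_self h]
      · exact (mul_div_cancel₀ _ h).symm
  choose s hs using key
  refine ⟨s, ?_⟩
  funext m
  induction m with
  | zero => funext k a; simp [planOf, hx.zero]
  | succ m ih =>
    funext k a
    rw [planOf_succ, ih, ← hs, Fin.snoc_init_self]

end Plans

/-! ### Linear programming duality for the best reply of player 1 -/

section Duality

variable {K A : Type*} [Fintype K] [Fintype A]

/-- Weak duality for the recursive constraints. -/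
theorem IsPlan.sum_le {x : (t : ℕ) → (Fin t → K) → (Fin t → A) → ℝ} (hx : IsPlan x)
    {p : K → ℝ} (hp : ∀ k, 0 ≤ p k) (l : (t : ℕ) → (Fin (t + 1) → K) → (Fin t → A) → ℝ)
    (m : ℕ) (u : (Fin (m + 1) → K) → (Fin (m + 1) → A) → ℝ)
    (hu : ∀ k a, u k a ≤ l m k (Fin.init a))
    (hl : ∀ t < m, ∀ (k : Fin (t + 1) → K) (a : Fin (t + 1) → A),
      ∑ k', l (t + 1) (Fin.snoc k k') a ≤ l t k (Fin.init a)) :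
    ∑ k, ∑ a, p (k 0) * x (m + 1) k a * u k a ≤ ∑ k, p k * l 0 (fun _ => k) Fin.elim0 := by
  have step : ∑ k, ∑ a, p (k 0) * x (m + 1) k a * u k a ≤
      ∑ k, ∑ a, p (k 0) * x m (Fin.init k) a * l m k a := by
    refine Finset.sum_le_sum fun k _ => ?_
    rw [sum_snoc]
    refine Finset.sum_le_sum fun a _ => ?_
    rw [← hx.sum_eq, Finset.mul_sum, Finset.sum_mul]
    refine Finset.sum_le_sum fun a' _ => mul_le_mul_of_nonneg_left ?_
      (mul_nonneg (hp _) (hx.nonneg _ _ _))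
    exact (hu _ _).trans_eq (by rw [Fin.init_snoc])
  refine step.trans ?_
  -- The terminal payoff has been absorbed into `l m`; what remains telescopes down to stage 0.
  clear step hu u
  induction m with
  | zero =>
    rw [← (Equiv.funUnique (Fin 1) K).symm.sum_comp]
    refine Finset.sum_le_sum fun k _ => ?_
    rw [Fintype.sum_unique, hx.zero, mul_one, Subsingleton.elim (default : Fin 0 → A) Fin.elim0]
    rfl
  | succ m ih =>
    refine le_trans ?_ (ih fun t ht => hl t (by omega))
    rw [sum_snoc]
    refine Finset.sum_le_sum fun k _ => ?_
    rw [Finset.sum_comm, sum_snoc]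
    refine Finset.sum_le_sum fun a _ => ?_
    rw [← hx.sum_eq, Finset.mul_sum, Finset.sum_mul]
    refine Finset.sum_le_sum fun a' _ => ?_
    -- The weight does not involve the last state, so summing over that state acts on `l` alone and
    -- the recursive constraint applies.
    simp only [snoc_zero, Fin.init_snoc, ← Finset.mul_sum]
    refine mul_le_mul_of_nonneg_left ((hl m (by omega) _ _).trans_eq ?_)
      (mul_nonneg (hp _) (hx.nonneg _ _ _))
    rw [Fin.init_snoc]

open Classical in
/-- The strategy that plays the pure strategy `f`. -/
def pureStrategy (f : (t : ℕ) → (Fin (t + 1) → K) → (Fin t → A) → A) :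
    (t : ℕ) → (Fin (t + 1) → K) → (Fin t → A) → stdSimplex ℝ A :=
  fun t k a => ⟨Pi.single (f t k a) 1, single_mem_stdSimplex ℝ _⟩

theorem sum_planOf_pureStrategy (p : K → ℝ)
    (f : (t : ℕ) → (Fin (t + 1) → K) → (Fin t → A) → A) (m : ℕ)
    (u : (Fin (m + 1) → K) → (Fin (m + 1) → A) → ℝ) :
    ∑ k, ∑ a, p (k 0) * planOf (pureStrategy f) (m + 1) k a * u k a =
      ∑ k, ∑ a, p (k 0) * planOf (pureStrategy f) m (Fin.init k) a *
        u k (Fin.snoc a (f m k a)) := by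
  classical
  refine Finset.sum_congr rfl fun k _ => ?_
  rw [sum_snoc]
  refine Finset.sum_congr rfl fun a _ => ?_
  rw [Finset.sum_eq_single (f m k a)]
  · simp [planOf_succ, pureStrategy]
  · intro a' _ h
    simp [planOf_succ, pureStrategy, h]
  · simp

-- The first `m` actions use only the rules of stages before `m`.
omit [Fintype K] in
theorem planOf_update (f : (t : ℕ) → (Fin (t + 1) → K) → (Fin t → A) → A) {m r : ℕ} (hmr : m ≤ r)
    (g : (Fin (r + 1) → K) → (Fin r → A) → A) :
    planOf (pureStrategy (Function.update f r g)) m = planOf (pureStrategy f) m := by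
  funext k a
  refine Finset.prod_congr rfl fun t _ => ?_
  have h : Function.update f r g t = f t := Function.update_of_ne (by omega) _ _
  simp only [pureStrategy, h]

/-- Backward induction: for a given terminal payoff, some pure strategy attains the bound of
`IsPlan.sum_le`. -/
theorem exists_pureStrategy_eq [Nonempty A] (p : K → ℝ) (m : ℕ)
    (u : (Fin (m + 1) → K) → (Fin (m + 1) → A) → ℝ) :
    ∃ (l : (t : ℕ) → (Fin (t + 1) → K) → (Fin t → A) → ℝ)
      (f : (t : ℕ) → (Fin (t + 1) → K) → (Fin t → A) → A),
      (∀ k a, u k a ≤ l m k (Fin.init a)) ∧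
      (∀ t < m, ∀ (k : Fin (t + 1) → K) (a : Fin (t + 1) → A),
        ∑ k', l (t + 1) (Fin.snoc k k') a ≤ l t k (Fin.init a)) ∧
      ∑ k, ∑ a, p (k 0) * planOf (pureStrategy f) (m + 1) k a * u k a =
        ∑ k, p k * l 0 (fun _ => k) Fin.elim0 := by
  induction m with
  | zero =>
    have hmax : ∀ (k : Fin 1 → K) (a : Fin 0 → A), ∃ b, ∀ a',
      u k (Fin.snoc a a') ≤ u k (Fin.snoc a b) := fun k a => Finite.exists_max _
    choose g hg using hmax
    refine ⟨Function.update 0 0 fun k a => u k (Fin.snoc a (g k a)),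
      Function.update (fun _ _ _ => Classical.arbitrary A) 0 g, fun k a => ?_,
      fun t ht => by omega, ?_⟩
    · simpa only [Function.update_self, Fin.snoc_init_self] using hg k (Fin.init a) (a (Fin.last 0))
    · rw [sum_planOf_pureStrategy, ← (Equiv.funUnique (Fin 1) K).symm.sum_comp]
      refine Finset.sum_congr rfl fun k _ => ?_
      rw [Fintype.sum_unique, (isPlan_planOf _).zero, mul_one,
        Subsingleton.elim (default : Fin 0 → A) Fin.elim0]
      simp only [Function.update_self]
      rfl
  | succ m ih =>
    have hmax : ∀ (k : Fin (m + 2) → K) (a : Fin (m + 1) → A), ∃ b, ∀ a',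
      u k (Fin.snoc a a') ≤ u k (Fin.snoc a b) := fun k a => Finite.exists_max _
    choose g hg using hmax
    -- The shorter problem has as terminal payoff the sum over the next state of the payoff under
    -- the best last action. The sum is unweighted, since transition probabilities are part of `u`.
    obtain ⟨l, f, hu, hl, heq⟩ :=
      ih fun k a => ∑ k', u (Fin.snoc k k') (Fin.snoc a (g (Fin.snoc k k') a))
    refine ⟨Function.update l (m + 1) fun k a => u k (Fin.snoc a (g k a)),
      Function.update f (m + 1) g, fun k a => ?_, fun t ht k a => ?_, ?_⟩
    · simpa only [Function.update_self, Fin.snoc_init_self] using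
        hg k (Fin.init a) (a (Fin.last (m + 1)))
    · rw [Function.update_of_ne (a := t) (by omega)]
      obtain rfl | h := eq_or_ne t m
      · simpa only [Function.update_self] using hu k a
      · rw [Function.update_of_ne (by omega)]
        exact hl t (by omega) k a
    · rw [Function.update_of_ne (a := 0) (by omega), ← heq, sum_planOf_pureStrategy,
        planOf_update f le_rfl, sum_snoc]
      refine Finset.sum_congr rfl fun k _ => ?_
      rw [Finset.sum_comm]
      refine Finset.sum_congr rfl fun a _ => ?_
      simp only [snoc_zero, Fin.init_snoc, ← Finset.mul_sum, Function.update_self]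

end Duality

variable {K A B : Type*} [Fintype K] [Fintype A] [Fintype B]

omit [Fintype A] [Fintype B] in
theorem transProb_succ (G : StochGame K A B) {m : ℕ} (k : Fin (m + 2) → K)
    (a : Fin (m + 2) → A) :
    G.transProb k a = G.transProb (Fin.init k) (Fin.init a) *
      G.Q (Fin.init a (Fin.last m)) (Fin.init k (Fin.last m)) (k (Fin.last (m + 1))) :=
  Fin.prod_univ_castSucc (n := m) fun t : Fin (m + 1) =>
    G.Q (a ⟨t, by omega⟩) (k ⟨t, by omega⟩) (k ⟨t + 1, by omega⟩)

/-! ### Summing out stages of a play -/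

section Play

variable (G : StochGame K A B)
  (σ : (t : ℕ) → (Fin (t + 1) → K) → (Fin t → A) → (Fin t → B) → stdSimplex ℝ A)
  (τ : (t : ℕ) → (Fin t → A) → (Fin t → B) → stdSimplex ℝ B)

theorem playProb_succ {m : ℕ} (k : Fin (m + 2) → K) (a : Fin (m + 2) → A) (b : Fin (m + 2) → B) :
    G.playProb (n := m + 2) (fun t => σ t) (fun t => τ t) k a b =
      G.playProb (n := m + 1) (fun t => σ t) (fun t => τ t) (Fin.init k) (Fin.init a)
          (Fin.init b) *
        (G.Q (Fin.init a (Fin.last m)) (Fin.init k (Fin.last m)) (k (Fin.last (m + 1))) *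
        ((σ (m + 1) k (Fin.init a) (Fin.init b)).1 (a (Fin.last (m + 1))) *
        (τ (m + 1) (Fin.init a) (Fin.init b)).1 (b (Fin.last (m + 1))))) := by
  rw [playProb, playProb, transProb_succ, Fin.prod_univ_castSucc]
  simp only [before_castSucc, before_last, upTo_castSucc, upTo_last, init_zero, Fin.init_def,
    Fin.val_castSucc, Fin.val_last]
  ring

/-- The last stage can be summed out. -/
theorem sum_playProb_init {m : ℕ} (F : (Fin (m + 1) → K) → (Fin (m + 1) → A) →
    (Fin (m + 1) → B) → ℝ) :
    ∑ k, ∑ a, ∑ b, G.playProb (n := m + 2) (fun t => σ t) (fun t => τ t) k a b *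
        F (Fin.init k) (Fin.init a) (Fin.init b) =
      ∑ k, ∑ a, ∑ b, G.playProb (n := m + 1) (fun t => σ t) (fun t => τ t) k a b * F k a b := by
  rw [sum_snoc]
  refine Finset.sum_congr rfl fun k _ => ?_
  rw [Finset.sum_comm, sum_snoc]
  refine Finset.sum_congr rfl fun a _ => ?_
  have h1 : ∀ k' a' , ∑ b, G.playProb (n := m + 2) (fun t => σ t) (fun t => τ t) (Fin.snoc k k')
      (Fin.snoc a a') b * F (Fin.init (Fin.snoc k k' : Fin (m + 2) → K))
        (Fin.init (Fin.snoc a a' : Fin (m + 2) → A)) (Fin.init b) =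
      ∑ b, G.playProb (n := m + 1) (fun t => σ t) (fun t => τ t) k a b * F k a b *
        (G.Q (a (Fin.last m)) (k (Fin.last m)) k' * (σ (m + 1) (Fin.snoc k k') a b).1 a') := by
    intro k' a'
    rw [sum_snoc]
    refine Finset.sum_congr rfl fun b _ => ?_
    simp only [playProb_succ, Fin.init_snoc, Fin.snoc_last]
    rw [← mul_one (_ * _ * (_ * _)), ← (τ (m + 1) a b).2.2, Finset.mul_sum]
    refine Finset.sum_congr rfl fun b' _ => ?_
    ring
  simp only [h1]
  -- The law of the last action of player 1 depends on the last state, so the action is summed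
  -- innermost and the state after it.
  rw [Finset.sum_comm]
  simp only [Finset.sum_comm (s := (Finset.univ : Finset A))]
  rw [Finset.sum_comm]
  refine Finset.sum_congr rfl fun b _ => ?_
  simp only [← Finset.mul_sum, (σ _ _ _ _).2.2, mul_one, (G.Q_mem _ _).2]

variable (y : (t : ℕ) → (Fin t → A) → stdSimplex ℝ B)

/-- The action of the uninformed player at stage `t` can be replaced by its conditional law. -/
theorem sum_playProb_mul_sub (M : K → A → B → ℝ) : ∀ {m : ℕ} (t : Fin (m + 1)),
    ∑ k, ∑ a, ∑ b, G.playProb (n := m + 1) (fun t => σ t) (fun t I _ => y t I) k a b *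
      (M (k t) (a t) (b t) - ∑ b', M (k t) (a t) b' * (y t (before a t)).1 b') = 0 := by
  -- At the last stage `b` enters only through its own factor and the payoff, whose deviation from
  -- the mean averages to zero. Earlier stages reduce to this one by dropping later stages.
  have hlast : ∀ m : ℕ,
      ∑ k, ∑ a, ∑ b, G.playProb (n := m + 1) (fun t => σ t) (fun t I _ => y t I) k a b *
        (M (k (Fin.last m)) (a (Fin.last m)) (b (Fin.last m)) -
          ∑ b', M (k (Fin.last m)) (a (Fin.last m)) b' * (y m (Fin.init a)).1 b') = 0 := by
    intro m
    refine Finset.sum_eq_zero fun k _ => Finset.sum_eq_zero fun a _ => ?_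
    rw [sum_snoc]
    refine Finset.sum_eq_zero fun b _ => ?_
    simp only [playProb, Fin.prod_univ_castSucc, before_castSucc, before_last, upTo_castSucc,
      upTo_last, Fin.val_castSucc, Fin.val_last, Fin.init_snoc, Fin.snoc_last, Fin.snoc_castSucc]
    set N := ∑ b', M (k (Fin.last m)) (a (Fin.last m)) b' * (y m (Fin.init a)).1 b' with hN
    have : ∑ b', (M (k (Fin.last m)) (a (Fin.last m)) b' - N) * (y m (Fin.init a)).1 b' = 0 := by
      simp only [sub_mul, Finset.sum_sub_distrib, ← Finset.mul_sum, (y m (Fin.init a)).2.2, ← hN]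
      ring
    simp only [mul_assoc, mul_comm ((y m (Fin.init a)).1 _), ← Finset.mul_sum, this, mul_zero]
  intro m
  induction m with
  | zero =>
    intro t
    obtain rfl : t = Fin.last 0 := Fin.ext (by simp)
    exact hlast 0
  | succ m ih =>
    intro t
    induction t using Fin.lastCases with
    | last => exact hlast (m + 1)
    | cast t =>
      rw [← ih t]
      exact sum_playProb_init G σ (fun t I _ => y t I) fun k a b =>
        M (k t) (a t) (b t) - ∑ b', M (k t) (a t) b' * (y t (before a t)).1 b'

end Play

/-- The expected total payoff along the states `k` and actions `a` if the uninformed player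
plays the mixed actions `y`. -/
def meanPayoff (G : StochGame K A B) {n : ℕ} (y : (t : ℕ) → (Fin t → A) → B → ℝ)
    (k : Fin n → K) (a : Fin n → A) : ℝ :=
  ∑ t : Fin n, ∑ b, G.M (k t) (a t) b * y t (before a t) b

/-- The payoff in terms of a realization plan of the informed player and of the mixed actions
of the uninformed player. -/
def planPayoff (G : StochGame K A B) (m : ℕ) (x : (t : ℕ) → (Fin t → K) → (Fin t → A) → ℝ)
    (y : (t : ℕ) → (Fin t → A) → B → ℝ) : ℝ :=
  ∑ k, ∑ a, G.p (k 0) * x (m + 1) k a * (G.transProb k a * G.meanPayoff y k a)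

/-! ### Reduction of strategies to plans and marginals -/

section Reduction

variable (G : StochGame K A B)

/-- The realization plan induced by a pair of strategies. -/
def inducedPlan (σ : (t : ℕ) → (Fin (t + 1) → K) → (Fin t → A) → (Fin t → B) → stdSimplex ℝ A)
    (τ : (t : ℕ) → (Fin t → A) → (Fin t → B) → stdSimplex ℝ B)
    (m : ℕ) (k : Fin m → K) (a : Fin m → A) : ℝ :=
  ∑ b : Fin m → B, ∏ t : Fin m,
    ((σ t (upTo k t) (before a t) (before b t)).1 (a t) * (τ t (before a t) (before b t)).1 (b t))

omit [Fintype K] in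
theorem isPlan_inducedPlan
    (σ : (t : ℕ) → (Fin (t + 1) → K) → (Fin t → A) → (Fin t → B) → stdSimplex ℝ A)
    (τ : (t : ℕ) → (Fin t → A) → (Fin t → B) → stdSimplex ℝ B) :
    IsPlan (inducedPlan σ τ) where
  zero k a := by simp [inducedPlan]
  nonneg t k a := Finset.sum_nonneg fun b _ => Finset.prod_nonneg fun s _ =>
    mul_nonneg ((σ _ _ _ _).2.1 _) ((τ _ _ _).2.1 _)
  sum_eq t k a := by
    simp only [inducedPlan]
    rw [Finset.sum_comm, sum_snoc]
    refine Finset.sum_congr rfl fun b _ => ?_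
    simp only [Fin.prod_univ_castSucc, before_castSucc, before_last, upTo_castSucc, upTo_last,
      Fin.val_castSucc, Fin.val_last, Fin.init_snoc, Fin.snoc_last, Fin.snoc_castSucc]
    simp only [← Finset.mul_sum, ← Finset.sum_mul, (σ _ _ _ _).2.2, (τ _ _ _).2.2, mul_one]

/-- Once each stage payoff is replaced by its conditional mean, the integrand no longer involves
`b`; summing `b` out of the play probability leaves the induced plan. -/
theorem payoff_eq_planPayoff {m : ℕ}
    (σ : (t : ℕ) → (Fin (t + 1) → K) → (Fin t → A) → (Fin t → B) → stdSimplex ℝ A)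
    (y : (t : ℕ) → (Fin t → A) → stdSimplex ℝ B) :
    G.payoff (n := m + 1) (fun t => σ t) (fun t I _ => y t I) =
      G.planPayoff m (inducedPlan σ fun t I _ => y t I) fun t I => (y t I).1 := by
  have h : ∑ t : Fin (m + 1), ∑ k, ∑ a, ∑ b,
      G.playProb (n := m + 1) (fun t => σ t) (fun t I _ => y t I) k a b *
      (G.M (k t) (a t) (b t) - ∑ b', G.M (k t) (a t) b' * (y t (before a t)).1 b') = 0 :=
    Finset.sum_eq_zero fun t _ => sum_playProb_mul_sub G σ y (fun k a b => G.M k a b) t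
  have h' : G.payoff (n := m + 1) (fun t => σ t) (fun t I _ => y t I) -
      ∑ k, ∑ a, ∑ b, G.playProb (n := m + 1) (fun t => σ t) (fun t I _ => y t I) k a b *
        G.meanPayoff (fun t I => (y t I).1) k a = 0 := by
    simp only [payoff, ← Finset.sum_sub_distrib]
    refine Eq.trans ?_ h
    rw [Finset.sum_comm (s := (Finset.univ : Finset (Fin (m + 1))))]
    refine Finset.sum_congr rfl fun k _ => ?_
    rw [Finset.sum_comm (s := (Finset.univ : Finset (Fin (m + 1))))]
    refine Finset.sum_congr rfl fun a _ => ?_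
    rw [Finset.sum_comm (s := (Finset.univ : Finset (Fin (m + 1))))]
    refine Finset.sum_congr rfl fun b _ => ?_
    rw [← Finset.mul_sum, Finset.sum_sub_distrib, mul_sub]
    rfl
  rw [sub_eq_zero.1 h', planPayoff]
  refine Finset.sum_congr rfl fun k _ => Finset.sum_congr rfl fun a _ => ?_
  rw [inducedPlan, Finset.mul_sum, Finset.sum_mul]
  refine Finset.sum_congr rfl fun b _ => ?_
  rw [playProb]
  ring

/-- The law of the action of the uninformed player at stage `t` given the previous actions of
the informed player. -/
def marginal (τ : (t : ℕ) → (Fin t → A) → (Fin t → B) → stdSimplex ℝ B) (t : ℕ) (I : Fin t → A)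
    (b : B) : ℝ :=
  ∑ J : Fin t → B, (∏ s : Fin t, (τ s (before I s) (before J s)).1 (J s)) * (τ t I J).1 b

-- The factors of stages after `t` sum to one, which leaves the law of the `t`-th action.
omit [Fintype A] in
theorem sum_prod_mul (τ : (t : ℕ) → (Fin t → A) → (Fin t → B) → stdSimplex ℝ B) :
    ∀ {m : ℕ} (a : Fin m → A) (t : Fin m) (f : B → ℝ),
    ∑ b : Fin m → B, (∏ s : Fin m, (τ s (before a s) (before b s)).1 (b s)) * f (b t) =
      ∑ b, f b * marginal τ t (before a t) b
  | m + 1, a, t, f => by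
    rw [sum_snoc]
    simp only [Fin.prod_univ_castSucc, before_castSucc, before_last,
      Fin.val_castSucc, Fin.val_last, Fin.init_snoc, Fin.snoc_last, Fin.snoc_castSucc]
    induction t using Fin.lastCases with
    | last =>
      simp only [Fin.snoc_last, marginal, before_last, Finset.mul_sum, Fin.val_last]
      rw [Finset.sum_comm]
      refine Finset.sum_congr rfl fun b _ => Finset.sum_congr rfl fun J _ => ?_
      ring
    | cast t =>
      simp only [Fin.snoc_castSucc, before_castSucc, Fin.val_castSucc]
      rw [← sum_prod_mul τ (Fin.init a) t f]
      refine Finset.sum_congr rfl fun b _ => ?_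
      simp only [← Finset.mul_sum, ← Finset.sum_mul, (τ _ _ _).2.2, mul_one]

omit [Fintype A] in
theorem sum_prod_eq_one (τ : (t : ℕ) → (Fin t → A) → (Fin t → B) → stdSimplex ℝ B) :
    ∀ {m : ℕ} (a : Fin m → A),
    ∑ b : Fin m → B, ∏ s : Fin m, (τ s (before a s) (before b s)).1 (b s) = 1
  | 0, a => by simp
  | m + 1, a => by
    rw [sum_snoc, ← sum_prod_eq_one τ (Fin.init a)]
    simp only [Fin.prod_univ_castSucc, before_castSucc, before_last,
      Fin.val_castSucc, Fin.val_last, Fin.init_snoc, Fin.snoc_last, Fin.snoc_castSucc,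
      ← Finset.mul_sum, (τ _ _ _).2.2, mul_one]

omit [Fintype A] in
theorem marginal_mem (τ : (t : ℕ) → (Fin t → A) → (Fin t → B) → stdSimplex ℝ B) (t : ℕ)
    (I : Fin t → A) : marginal τ t I ∈ stdSimplex ℝ B := by
  refine ⟨fun b => Finset.sum_nonneg fun J _ => mul_nonneg
    (Finset.prod_nonneg fun s _ => (τ _ _ _).2.1 _) ((τ _ _ _).2.1 _), ?_⟩
  simp only [marginal]
  rw [Finset.sum_comm]
  simp only [← Finset.mul_sum, (τ _ _ _).2.2, mul_one, sum_prod_eq_one]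

/-- The play probability factors into a part for each player, and the payoff is additive over
stages, so only the marginal of each `b t` given the actions of player 1 matters. -/
theorem payoff_planOf {m : ℕ} (s : (t : ℕ) → (Fin (t + 1) → K) → (Fin t → A) → stdSimplex ℝ A)
    (τ : (t : ℕ) → (Fin t → A) → (Fin t → B) → stdSimplex ℝ B) :
    G.payoff (n := m + 1) (fun t k a _ => s t k a) (fun t => τ t) =
      G.planPayoff m (planOf s) (marginal τ) := by
  refine Finset.sum_congr rfl fun k _ => Finset.sum_congr rfl fun a _ => ?_
  simp only [playProb, Finset.prod_mul_distrib, meanPayoff, ← sum_prod_mul τ a, planOf]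
  rw [Finset.sum_comm, Finset.mul_sum, Finset.mul_sum]
  refine Finset.sum_congr rfl fun b _ => ?_
  rw [← Finset.mul_sum]
  ring

end Reduction

/-! ### Bilinearity and the saddle point -/

section Minimax

variable (G : StochGame K A B)

theorem planPayoff_combo_left (m : ℕ) (x x' : (t : ℕ) → (Fin t → K) → (Fin t → A) → ℝ)
    (y : (t : ℕ) → (Fin t → A) → B → ℝ) (α β : ℝ) :
    G.planPayoff m (α • x + β • x') y = α * G.planPayoff m x y + β * G.planPayoff m x' y := by
  simp only [planPayoff, Finset.mul_sum, ← Finset.sum_add_distrib, Pi.add_apply, Pi.smul_apply,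
    smul_eq_mul]
  refine Finset.sum_congr rfl fun k _ => Finset.sum_congr rfl fun a _ => ?_
  ring

omit [Fintype A] in
theorem meanPayoff_combo {n : ℕ} (y y' : (t : ℕ) → (Fin t → A) → B → ℝ) (α β : ℝ)
    (k : Fin n → K) (a : Fin n → A) :
    G.meanPayoff (α • y + β • y') k a = α * G.meanPayoff y k a + β * G.meanPayoff y' k a := by
  simp only [meanPayoff, Finset.mul_sum, ← Finset.sum_add_distrib, Pi.add_apply, Pi.smul_apply,
    smul_eq_mul]
  refine Finset.sum_congr rfl fun t _ => Finset.sum_congr rfl fun b _ => ?_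
  ring

theorem planPayoff_combo_right (m : ℕ) (x : (t : ℕ) → (Fin t → K) → (Fin t → A) → ℝ)
    (y y' : (t : ℕ) → (Fin t → A) → B → ℝ) (α β : ℝ) :
    G.planPayoff m x (α • y + β • y') = α * G.planPayoff m x y + β * G.planPayoff m x y' := by
  simp only [planPayoff, Finset.mul_sum, ← Finset.sum_add_distrib, meanPayoff_combo]
  refine Finset.sum_congr rfl fun k _ => Finset.sum_congr rfl fun a _ => ?_
  ring

theorem exists_saddle [Nonempty A] [Nonempty B] (m : ℕ) :
    ∃ x : (t : ℕ) → (Fin t → K) → (Fin t → A) → ℝ, IsPlan x ∧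
    ∃ y : (t : ℕ) → (Fin t → A) → stdSimplex ℝ B,
      (∀ x', IsPlan x' → G.planPayoff m x' (fun t I => (y t I).1) ≤
        G.planPayoff m x fun t I => (y t I).1) ∧
      ∀ y' : (t : ℕ) → (Fin t → A) → stdSimplex ℝ B,
        G.planPayoff m x (fun t I => (y t I).1) ≤ G.planPayoff m x fun t I => (y' t I).1 := by
  let X : Set ((t : ℕ) → (Fin t → K) → (Fin t → A) → ℝ) := {x | IsPlan x}
  let Y : Set ((t : ℕ) → (Fin t → A) → B → ℝ) :=
    Set.univ.pi fun _ => Set.univ.pi fun _ => stdSimplex ℝ B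
  have neX : X.Nonempty := ⟨_, isPlan_planOf fun _ _ _ => Classical.arbitrary _⟩
  have neY : Y.Nonempty :=
    ⟨fun _ _ => (Classical.arbitrary (stdSimplex ℝ B)).1, fun _ _ _ _ => Subtype.coe_prop _⟩
  have cY : Convex ℝ Y := convex_pi fun _ _ => convex_pi fun _ _ => convex_stdSimplex ℝ B
  have kY : IsCompact Y :=
    isCompact_univ_pi fun _ => isCompact_univ_pi fun _ => isCompact_stdSimplex ℝ B
  -- The minimizer comes first here, so mixed actions take the first slot and plans the second.
  obtain ⟨y, hy, x, hx, h⟩ := Sion.exists_isSaddlePointOn (X := Y) (Y := X)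
    (f := fun y x => G.planPayoff m x y) neY cY kY
    (fun x _ => (Continuous.lowerSemicontinuous
      (by unfold planPayoff meanPayoff; fun_prop)).lowerSemicontinuousOn _)
    (fun x _ => ConvexOn.quasiconvexOn
      ⟨cY, fun y _ y' _ α β _ _ _ => (G.planPayoff_combo_right m x y y' α β).le⟩)
    convex_isPlan neX isCompact_isPlan
    (fun y _ => (Continuous.upperSemicontinuous
      (by unfold planPayoff; fun_prop)).upperSemicontinuousOn _)
    (fun y _ => ConcaveOn.quasiconcaveOn
      ⟨convex_isPlan, fun x _ x' _ α β _ _ _ => (G.planPayoff_combo_left m x x' y α β).ge⟩)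
  exact ⟨x, hx, fun t I => ⟨y t I, hy t trivial I trivial⟩, fun x' hx' => h y hy x' hx',
    fun y' => h _ (fun t _ I _ => (y' t I).2) x hx⟩

end Minimax

/-! ### Extending finite-stage strategies to all stages -/

section Extension

omit [Fintype K] [Fintype B] in
theorem InformedStrategy.exists_extension [Nonempty A] {n : ℕ} (σ : InformedStrategy K A B n) :
    ∃ σ' : (t : ℕ) → (Fin (t + 1) → K) → (Fin t → A) → (Fin t → B) → stdSimplex ℝ A,
      (fun t : Fin n => σ' t) = σ :=
  ⟨fun t => if h : t < n then σ ⟨t, h⟩ else fun _ _ _ => Classical.arbitrary _, by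
    funext t; simp⟩

omit [Fintype A] in
theorem UninformedStrategy.exists_extension [Nonempty B] {n : ℕ}
    (τ : UninformedStrategy A B n) :
    ∃ τ' : (t : ℕ) → (Fin t → A) → (Fin t → B) → stdSimplex ℝ B, (fun t : Fin n => τ' t) = τ :=
  ⟨fun t => if h : t < n then τ ⟨t, h⟩ else fun _ _ => Classical.arbitrary _, by
    funext t; simp⟩

end Extension

/-! ### Feasible solutions and best replies -/

section LinearProgram

variable (G : StochGame K A B) {m : ℕ}

omit [Fintype A] in
theorem uninformedLP_obj (z : LPVar K A B (m + 1) → ℝ) :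
    G.uninformedLP.obj z = ∑ k, G.p k * z (Sum.inr (initHist k)) := by
  simp [uninformedLP, lVar]

/-- A feasible solution of the linear program bounds the payoff of every realization plan. -/
theorem planPayoff_le_obj {z : LPVar K A B (m + 1) → ℝ} (hz : z ∈ G.uninformedLP.feasible)
    {x : (t : ℕ) → (Fin t → K) → (Fin t → A) → ℝ} (hx : IsPlan x)
    {y : (t : ℕ) → (Fin t → A) → B → ℝ}
    (hy : ∀ (t : Fin (m + 1)) (I : Fin t → A) (b : B), y t I b = z (Sum.inl (⟨t, I⟩, b))) :
    G.planPayoff m x y ≤ G.uninformedLP.obj z := by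
  -- The value 0 after the last stage is never used.
  let l : (t : ℕ) → (Fin (t + 1) → K) → (Fin t → A) → ℝ := fun t k a =>
    if h : t < m + 1 then z (Sum.inr ⟨⟨t, h⟩, k, a⟩) else 0
  have hl : ∀ (t : ℕ) (h : t < m + 1) k a, l t k a = z (Sum.inr ⟨⟨t, h⟩, k, a⟩) :=
    fun t h k a => dif_pos h
  rw [uninformedLP_obj]
  refine (hx.sum_le G.p_mem.1 l m _ (fun k a => ?_) fun t ht k a => ?_).trans_eq ?_
  · have h := hz.2 (Sum.inr (Sum.inr (k, a)))
    simp only [uninformedLP, LinearMap.sub_apply, LinearMap.smul_apply, LinearMap.sum_apply,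
      yVar, lVar, LinearMap.proj_apply, smul_eq_mul, ← hy] at h
    rw [hl m (by omega)]
    exact sub_nonpos.1 h
  · have h := hz.2 (Sum.inr (Sum.inl ⟨⟨t, ht⟩, k, a⟩))
    simp only [uninformedLP, LinearMap.sub_apply, LinearMap.sum_apply, lVar,
      LinearMap.proj_apply] at h
    simp only [hl t (by omega), hl (t + 1) (by omega)]
    exact sub_nonpos.1 h
  · exact Finset.sum_congr rfl fun k _ => by rw [hl 0 (by omega)]; rfl

/-- For given mixed actions of the uninformed player, the linear program has a feasible solution
whose objective is attained by a realization plan. -/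
theorem exists_feasible_obj_eq [Nonempty A] (y : (t : ℕ) → (Fin t → A) → stdSimplex ℝ B) :
    ∃ z ∈ (G.uninformedLP (n := m + 1)).feasible, ∃ x, IsPlan x ∧
      G.uninformedLP.obj z = G.planPayoff m x fun t I => (y t I).1 := by
  obtain ⟨l, f, hu, hl, h⟩ := exists_pureStrategy_eq G.p m fun k a =>
    G.transProb k a * G.meanPayoff (fun t I => (y t I).1) k a
  refine ⟨Sum.elim (fun i => (y i.1.1 i.1.2).1 i.2) fun F => l F.1 F.2.1 F.2.2,
    ⟨fun I => ?_, ?_⟩, _, isPlan_planOf (pureStrategy f), ?_⟩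
  · simpa [uninformedLP, yVar] using (y I.1 I.2).2.2
  · rintro (⟨I, b⟩ | s | ⟨k, a⟩)
    · simpa [uninformedLP, yVar] using (y I.1 I.2).2.1 b
    · simp only [uninformedLP, LinearMap.sub_apply, LinearMap.sum_apply, lVar,
        LinearMap.proj_apply, Sum.elim_inr]
      exact sub_nonpos.2 (hl s.1 s.1.2 s.2.1 s.2.2)
    · simp only [uninformedLP, LinearMap.sub_apply, LinearMap.smul_apply, LinearMap.sum_apply,
        yVar, lVar, LinearMap.proj_apply, smul_eq_mul, Sum.elim_inl, Sum.elim_inr]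
      exact sub_nonpos.2 (hu k a)
  · rw [uninformedLP_obj, planPayoff, h]
    rfl

omit [Fintype A] in
theorem exists_strategy_of_feasible [Nonempty B] {z : LPVar K A B (m + 1) → ℝ}
    (hz : z ∈ G.uninformedLP.feasible) :
    ∃ y : (t : ℕ) → (Fin t → A) → stdSimplex ℝ B,
      ∀ (t : Fin (m + 1)) (I : Fin t → A) (b : B), (y t I).1 b = z (Sum.inl (⟨t, I⟩, b)) := by
  have hmem : ∀ (t : Fin (m + 1)) (I : Fin t → A),
      (fun b => z (Sum.inl (⟨t, I⟩, b))) ∈ stdSimplex ℝ B := fun t I =>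
    ⟨fun b => by simpa [uninformedLP, yVar] using hz.2 (Sum.inl (⟨t, I⟩, b)),
      by simpa [uninformedLP, yVar] using hz.1 ⟨t, I⟩⟩
  refine ⟨fun t I => if h : t < m + 1 then ⟨_, hmem ⟨t, h⟩ I⟩ else Classical.arbitrary _, ?_⟩
  intro t I b
  simp [Nat.lt_succ_iff.1 t.2]

end LinearProgram

/-- The saddle plan bounds every feasible objective from below by `v`. Backward induction against
the saddle `y` gives a feasible point of objective at most `v`, so the optimum is `v`, and by weak
duality any optimal `y` concedes at most `v`. -/
theorem value_and_optimal [Nonempty A] [Nonempty B] (G : StochGame K A B) (m : ℕ) :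
    (∃ v : ℝ, G.IsValue (m + 1) v ∧ (G.uninformedLP (n := m + 1)).IsOptimum v) ∧
    ∀ z, (G.uninformedLP (n := m + 1)).IsOptimal z →
      ∃ τ : UninformedStrategy A B (m + 1),
        (∀ (t : Fin (m + 1)) (I : Fin t → A) (J : Fin t → B) (b : B),
          (τ t I J).1 b = z (Sum.inl (⟨t, I⟩, b))) ∧
        G.IsSecurityStrategy τ := by
  obtain ⟨x, hx, y, hxy, hyx⟩ := G.exists_saddle m
  obtain ⟨s, rfl⟩ := hx.exists_planOf
  set v := G.planPayoff m (planOf s) fun t I => (y t I).1 with hv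
  let σ₀ : InformedStrategy K A B (m + 1) := fun t k a _ => s t k a
  let τ₀ : UninformedStrategy A B (m + 1) := fun t I _ => y t I
  have lower : ∀ τ, v ≤ G.payoff σ₀ τ := by
    intro τ
    obtain ⟨τ', rfl⟩ := τ.exists_extension
    exact (hyx fun t I => ⟨marginal τ' t I, marginal_mem τ' t I⟩).trans_eq
      (G.payoff_planOf s τ').symm
  have upper : ∀ σ, G.payoff σ τ₀ ≤ v := by
    intro σ
    obtain ⟨σ', rfl⟩ := σ.exists_extension
    exact (G.payoff_eq_planPayoff σ' y).trans_le (hxy _ (isPlan_inducedPlan _ _))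
  have saddle : G.payoff σ₀ τ₀ = v := le_antisymm (upper σ₀) (lower τ₀)
  have hvalue : G.IsValue (m + 1) v := by
    refine ⟨⟨⟨σ₀, ⟨τ₀, saddle⟩, ?_⟩, ?_⟩, ⟨⟨τ₀, ⟨σ₀, saddle⟩, ?_⟩, ?_⟩⟩
    · rintro _ ⟨τ, rfl⟩
      exact lower τ
    · rintro w ⟨σ, hσ⟩
      exact (hσ.2 ⟨τ₀, rfl⟩).trans (upper σ)
    · rintro _ ⟨σ, rfl⟩
      exact upper σ
    · rintro w ⟨τ, hτ⟩
      exact (lower τ).trans (hτ.2 ⟨σ₀, rfl⟩)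
  have bound : ∀ z ∈ (G.uninformedLP (n := m + 1)).feasible, v ≤ G.uninformedLP.obj z := by
    intro z hz
    obtain ⟨y', hy'⟩ := G.exists_strategy_of_feasible hz
    exact (hyx y').trans (G.planPayoff_le_obj hz hx hy')
  obtain ⟨z₀, hz₀, x₀, hx₀, hobj⟩ := G.exists_feasible_obj_eq (m := m) y
  have hz₀v : G.uninformedLP.obj z₀ = v := le_antisymm (hobj.trans_le (hxy _ hx₀)) (bound z₀ hz₀)
  refine ⟨⟨v, hvalue, ⟨z₀, hz₀, hz₀v⟩, ?_⟩, fun z hz => ?_⟩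
  · rintro _ ⟨z, hz, rfl⟩
    exact bound z hz
  · obtain ⟨y', hy'⟩ := G.exists_strategy_of_feasible hz.1
    have upper' : ∀ σ : InformedStrategy K A B (m + 1),
        G.payoff σ (fun t I _ => y' t I) ≤ v := by
      intro σ
      obtain ⟨σ', rfl⟩ := σ.exists_extension
      rw [← hz₀v, G.payoff_eq_planPayoff σ' y']
      exact (G.planPayoff_le_obj hz.1 (isPlan_inducedPlan _ _) hy').trans (hz.2 z₀ hz₀)
    refine ⟨fun t I _ => y' t I, fun t I _ b => hy' t I b, v, hvalue.2,
      ⟨σ₀, le_antisymm (upper' σ₀) (lower _)⟩, ?_⟩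
    rintro _ ⟨σ, rfl⟩
    exact upper' σ

/-! ### Size of the linear program -/

section Size

theorem sum_range_pow_le {r : ℕ} (hr : 2 ≤ r) (n : ℕ) : ∑ t ∈ Finset.range n, r ^ t ≤ r ^ n := by
  induction n with
  | zero => simp
  | succ n ih =>
    rw [Finset.sum_range_succ, pow_succ]
    nlinarith [Nat.zero_le (r ^ n)]

theorem sum_range_pow_succ_le {r : ℕ} (hr : 2 ≤ r) (n : ℕ) :
    ∑ t ∈ Finset.range n, r ^ (t + 1) ≤ 2 * r ^ n := by
  simp only [pow_succ, ← Finset.sum_mul]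
  induction n with
  | zero => simp
  | succ n ih =>
    rw [Finset.sum_range_succ, pow_succ, add_mul]
    nlinarith [Nat.zero_le (r ^ n)]

theorem size_uninformedLP (G : StochGame K A B) {n : ℕ} [NeZero n] :
    (G.uninformedLP (n := n)).size =
      2 * ((∑ t ∈ Finset.range n, Fintype.card A ^ t) * Fintype.card B) +
      ∑ t ∈ Finset.range n, Fintype.card K ^ (t + 1) * Fintype.card A ^ t +
      ∑ t ∈ Finset.range n, Fintype.card A ^ t +
      ∑ t ∈ Finset.range (n - 1), (Fintype.card K * Fintype.card A) ^ (t + 1) +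
      (Fintype.card K * Fintype.card A) ^ n := by
  simp only [LinProg.size, Fintype.card_sum, Fintype.card_prod, Fintype.card_sigma,
    Fintype.card_fun, Fintype.card_fin, mul_pow,
    ← Fin.sum_univ_eq_sum_range (n := n), ← Fin.sum_univ_eq_sum_range (n := n - 1)]
  rw [Fin.sum_univ_eq_sum_range (fun t => Fintype.card A ^ t),
    Fin.sum_univ_eq_sum_range (fun t => Fintype.card K ^ (t + 1) * Fintype.card A ^ t)]
  ring

/-- With ratio at least 2, geometric sums are bounded by multiples of their top power. In the order
of `size_uninformedLP` the terms contribute 2 + 2 + 1 + 2 + 1 = 8. -/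
theorem size_le_of_two_le [Nonempty A] [Nonempty B] (G : StochGame K A B) {n : ℕ} [NeZero n]
    (h : 2 ≤ Fintype.card K * Fintype.card A) :
    (G.uninformedLP (n := n)).size ≤
      8 * (Fintype.card K ^ n * Fintype.card A ^ n * Fintype.card B) := by
  have hB : 1 ≤ Fintype.card B := Fintype.card_pos
  have hA : 1 ≤ Fintype.card A := Fintype.card_pos
  have hK : 1 ≤ Fintype.card K := Nat.pos_of_ne_zero fun h0 => by simp [h0] at h
  rw [size_uninformedLP, ← mul_pow]
  generalize Fintype.card A = a at *
  generalize Fintype.card B = b at *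
  generalize Fintype.card K = k at *
  set N := (k * a) ^ n with hN
  have hak : a ≤ k * a := Nat.le_mul_of_pos_left _ hK
  have h1 : ∑ t ∈ Finset.range n, a ^ t ≤ N :=
    (Finset.sum_le_sum fun t _ => Nat.pow_le_pow_left hak t).trans (sum_range_pow_le h n)
  have h2 : ∑ t ∈ Finset.range n, k ^ (t + 1) * a ^ t ≤ 2 * N := by
    refine (Finset.sum_le_sum fun t _ => ?_).trans (sum_range_pow_succ_le h n)
    rw [mul_pow]
    exact Nat.mul_le_mul_left _ (Nat.pow_le_pow_right hA (Nat.le_succ t))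
  have h3 : ∑ t ∈ Finset.range (n - 1), (k * a) ^ (t + 1) ≤ 2 * N :=
    (Finset.sum_le_sum_of_subset (Finset.range_subset_range.2 (Nat.sub_le n 1))).trans
      (sum_range_pow_succ_le h n)
  have h4 := Nat.mul_le_mul_right b h1
  have h5 : N ≤ N * b := Nat.le_mul_of_pos_right _ hB
  omega

theorem size_le [Nonempty A] [Nonempty B] (G : StochGame K A B) {n : ℕ} [NeZero n] :
    (G.uninformedLP (n := n)).size ≤
      8 * (n * (Fintype.card K ^ n * Fintype.card A ^ n * Fintype.card B)) := by
  have hB : 1 ≤ Fintype.card B := Fintype.card_pos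
  have hA : 1 ≤ Fintype.card A := Fintype.card_pos
  have hK : 1 ≤ Fintype.card K := by
    have hp := G.p_mem.2
    refine Nat.pos_of_ne_zero fun h0 => ?_
    have := Fintype.card_eq_zero_iff.1 h0
    simp at hp
  have hn : 1 ≤ n := NeZero.pos n
  rw [size_uninformedLP, ← mul_pow]
  generalize Fintype.card A = a at *
  generalize Fintype.card B = b at *
  generalize Fintype.card K = k at *
  set N := (k * a) ^ n with hN
  have hak : a ≤ k * a := Nat.le_mul_of_pos_left _ hK
  have hka : 1 ≤ k * a := hA.trans hak
  -- When |K||A| = 1 the sums are not geometric; counting terms costs the factor `n`.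
  have bound : ∀ {f : ℕ → ℕ}, (∀ t < n, f t ≤ N) → ∑ t ∈ Finset.range n, f t ≤ n * N := by
    intro f hf
    simpa using Finset.sum_le_card_nsmul (Finset.range n) f N fun t ht =>
      hf t (Finset.mem_range.1 ht)
  have h1 : ∑ t ∈ Finset.range n, a ^ t ≤ n * N := bound fun t ht =>
    (Nat.pow_le_pow_left hak t).trans (Nat.pow_le_pow_right hka ht.le)
  have h2 : ∑ t ∈ Finset.range n, k ^ (t + 1) * a ^ t ≤ n * N := bound fun t ht => by
    rw [hN, mul_pow]
    exact Nat.mul_le_mul (Nat.pow_le_pow_right hK ht) (Nat.pow_le_pow_right hA ht.le)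
  have h3 : ∑ t ∈ Finset.range (n - 1), (k * a) ^ (t + 1) ≤ n * N :=
    (Finset.sum_le_sum_of_subset (Finset.range_subset_range.2 (Nat.sub_le n 1))).trans
      (bound fun t ht => Nat.pow_le_pow_right hka ht)
  have h4 := Nat.mul_le_mul_right b h1
  have h5 : n * N ≤ n * N * b := Nat.le_mul_of_pos_right _ hB
  have h6 : N ≤ n * N := Nat.le_mul_of_pos_left _ hn
  rw [← mul_assoc n N b]
  omega

end Size

end StochGame

end

theorem mainTheorem6 :
    ∃ c : ℝ, ∀ (K A B : Type*) [Fintype K] [Fintype A] [Fintype B] [Nonempty A] [Nonempty B]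
      (n : ℕ) [NeZero n] (G : StochGame K A B),
      (∃ v : ℝ, G.IsValue n v ∧ (G.uninformedLP (n := n)).IsOptimum v) ∧
      (∀ x, (G.uninformedLP (n := n)).IsOptimal x →
        ∃ τ : StochGame.UninformedStrategy A B n,
          (∀ (t : Fin n) (I : Fin t → A) (J : Fin t → B) (b : B),
            (τ t I J).1 b = x (Sum.inl (⟨t, I⟩, b))) ∧
          G.IsSecurityStrategy τ) ∧
      (2 ≤ Fintype.card K * Fintype.card A →
        ((G.uninformedLP (n := n)).size : ℝ) ≤
          c * ((Fintype.card K : ℝ) ^ n * (Fintype.card A : ℝ) ^ n * (Fintype.card B : ℝ))) ∧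
      ((G.uninformedLP (n := n)).size : ℝ) ≤
        c * (n * ((Fintype.card K : ℝ) ^ n * (Fintype.card A : ℝ) ^ n * (Fintype.card B : ℝ))) := by
  refine ⟨8, fun K A B _ _ _ _ _ n _ G => ?_⟩
  obtain ⟨m, rfl⟩ := Nat.exists_eq_succ_of_ne_zero (NeZero.ne n)
  exact ⟨(G.value_and_optimal m).1, (G.value_and_optimal m).2, fun h => by exact_mod_cast G.size_le_of_two_le h,
    by exact_mod_cast G.size_le⟩
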